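/- Let $R$ be a commutative noetherian ring, $n\ge 0$, $R[[t]][x]:=R[[t]][x_1,\dots,x_n]$ and $R[t,x]:=R[t,x_1,\dots,x_n]$. Write $f\in R[[t]][x]$ as $f=\sum_{\beta,\alpha}c_{\alpha,\beta}\,t^\beta x^\alpha$. An ideal of $R[[t]][x]$ is called $x$-homogeneous if it is generated by elements that are homogeneous as polynomials in $x$ over $R[[t]]$. A monomial ordering $>$ is a total ordering of the monomials $t^\beta x^\alpha$ compatible with multiplication; it is $t$-local if $1>t$. For a $t$-local ordering and $f\neq 0$, the leading term $\mathrm{lt}_>(f)$ is the term of $f$ whose monomial is the greatest one (with respect to $>$) occurring in $f$, $\mathrm{tail}_>(f)=f-\mathrm{lt}_>(f)$, and $\mathrm{lt}_>(0)=0$. For a subset $S\subseteq R[[t]][x]$, in particular for an ideal, let $\mathrm{lt}_>(S)$ denote the ideal $\langle \mathrm{lt}_>(f)\mid f\in S\rangle$ of $R[t,x]$. For $w=(w_0,\dots,w_n)\in\mathbb{R}_{<0}\times\mathbb{R}^n$, the initial form $\mathrm{in}_w(f)\in R[t,x]$ is the sum of those terms $c_{\alpha,\beta}t^\beta x^\alpha$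 of $f$ for which $w\cdot(\beta,\alpha)$ is maximal, and $\mathrm{in}_w(I)=\langle \mathrm{in}_w(f)\mid f\in I\rangle\unlhd R[t,x]$. Let $$C_>(I)=\overline{\{v\in\mathbb{R}_{<0}\times\mathbb{R}^n\mid \mathrm{in}_v(I)=\mathrm{lt}_>(I)\}},$$ the closure being taken in the Euclidean topology. A standard basis of $I$ with respect to $>$ is a finite subset $G\subseteq I$ with $\mathrm{lt}_>(G)=\mathrm{lt}_>(I)$. It is called initially reduced if * no proper subset of the set $\{\mathrm{lt}_>(g)\mid g\in G\}$ generates $\mathrm{lt}_>(I)$, and * for every $g=\sum_\alpha g_\alpha x^\alpha\in G$ with $g_\alpha\in R[[t]]$, no (nonzero) term of $\mathrm{tail}_>(g')$ lies in $\mathrm{lt}_>(G)$, where $g'=\sum_\alpha \mathrm{lt}_>(g_\alpha)\,x^\alpha$. **Proposition.** Let $I\unlhd R[[t]][x]$ be an $x$-homogeneous ideal, let $>$ be a $t$-local monomial ordering, let $G$ be an initially reduced standard basis of $I$ with respect to $>$, and let $w\in C_>(I)$ with $w_0<0$. Then for all $v\in\mathbb{R}_{<0}\times\mathbb{R}^n$,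 $$\mathrm{in}_v(I)=\mathrm{in}_w(I)\quad\Longleftrightarrow\quad \mathrm{in}_v(g)=\mathrm{in}_w(g)\ \text{ for all } g\in G.$$ -/

import Mathlib

namespace GroebnerFan

noncomputable section

/-- The mixed power series polynomial ring `R⟦t⟧[x₁, …, xₙ]`. -/
abbrev Mixed (n : ℕ) (R : Type*) [CommRing R] := MvPolynomial (Fin n) (PowerSeries R)

/-- The polynomial ring `R[t, x₁, …, xₙ]`; the variable with index `0` is `t`. -/
abbrev Poly (n : ℕ) (R : Type*) [CommRing R] := MvPolynomial (Fin (n + 1)) R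

/-- Exponent vectors `(β, α)` of the monomials `t ^ β * x ^ α`; the entry with index `0` is `β`.
Multiplication of monomials is addition of exponent vectors. -/
abbrev Mon (n : ℕ) := Fin (n + 1) →₀ ℕ

/-- A monomial ordering on `Mon(t, x)`: a (strict) total ordering compatible with multiplication.
It is not required to be a well-ordering. -/
structure MonomialOrdering (n : ℕ) where
  gt : Mon n → Mon n → Prop
  irrefl : ∀ a, ¬ gt a a
  trans : ∀ a b c, gt a b → gt b c → gt a c
  total : ∀ a b, a ≠ b → gt a b ∨ gt b a
  add_right : ∀ a b c, gt a b → gt (a + c) (b + c)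

/-- An ordering is `t`-local if `1 > t`. -/
def MonomialOrdering.IsTLocal {n : ℕ} (o : MonomialOrdering n) : Prop :=
  o.gt 0 (Finsupp.single 0 1)

variable {n : ℕ} {R : Type*} [CommRing R]

/-- The coefficient `c_{α,β}` of `t ^ β * x ^ α` in `f ∈ R⟦t⟧[x]`, where `m = (β, α)`. -/
def mcoeff (m : Mon n) (f : Mixed n R) : R :=
  PowerSeries.coeff (m 0) (MvPolynomial.coeff m.tail f)

/-- The set of monomials occurring in `f ∈ R⟦t⟧[x]`. -/
def msupport (f : Mixed n R) : Set (Mon n) := {m | mcoeff m f ≠ 0}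

/-- The canonical embedding `R[t, x] → R⟦t⟧[x]`. -/
def toMixed : Poly n R →ₐ[R] Mixed n R :=
  MvPolynomial.aeval
    (Fin.cons (MvPolynomial.C PowerSeries.X) (fun i => MvPolynomial.X i) : Fin (n + 1) → Mixed n R)

/-- `m` is the leading monomial of `f`: the greatest monomial occurring in `f`. -/
def IsLeadingMonomial (o : MonomialOrdering n) (f : Mixed n R) (m : Mon n) : Prop :=
  m ∈ msupport f ∧ ∀ m' ∈ msupport f, m' ≠ m → o.gt m m'

open Classical in
/-- The leading term `lt_>(f) ∈ R[t, x]`, with `lt_>(0) = 0`. For a `t`-local ordering every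
`f ≠ 0` has a (unique) leading monomial, see `exists_isLeadingMonomial`. -/
def leadingTerm (o : MonomialOrdering n) (f : Mixed n R) : Poly n R :=
  if h : ∃ m, IsLeadingMonomial o f m then
    MvPolynomial.monomial h.choose (mcoeff h.choose f)
  else 0

/-- `tail_>(f) = f - lt_>(f)`. -/
def tail (o : MonomialOrdering n) (f : Mixed n R) : Mixed n R :=
  f - toMixed (leadingTerm o f)

/-- The ideal `⟨lt_>(f) | f ∈ S⟩` of `R[t, x]`, for a subset `S` of `R⟦t⟧[x]`. For an ideal `S = I`
this is the leading ideal `lt_>(I)`. -/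
def leadingIdeal (o : MonomialOrdering n) (S : Set (Mixed n R)) : Ideal (Poly n R) :=
  Ideal.span (leadingTerm o '' S)

/-- The scalar product `w · (β, α)`. -/
def wdeg (w : Fin (n + 1) → ℝ) (m : Mon n) : ℝ := ∑ i, w i * (m i : ℝ)

/-- The monomials of `f` of maximal weight. -/
def initialSupport (w : Fin (n + 1) → ℝ) (f : Mixed n R) : Set (Mon n) :=
  {m | m ∈ msupport f ∧ ∀ m' ∈ msupport f, wdeg w m' ≤ wdeg w m}

/-- The initial form `in_w(f) ∈ R[t, x]`, the sum of the terms of `f` of maximal weight. For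
`w₀ < 0` this is a finite sum, see `initialSupport_finite`. -/
def initialForm (w : Fin (n + 1) → ℝ) (f : Mixed n R) : Poly n R :=
  ∑ᶠ m ∈ initialSupport w f, MvPolynomial.monomial m (mcoeff m f)

/-- The initial ideal `in_w(I) = ⟨in_w(f) | f ∈ I⟩` of `R[t, x]`. -/
def initialIdeal (w : Fin (n + 1) → ℝ) (I : Ideal (Mixed n R)) : Ideal (Poly n R) :=
  Ideal.span (initialForm w '' (I : Set (Mixed n R)))

/-- The cone `C_>(I)`, the Euclidean closure of `{v ∈ ℝ_{<0} × ℝⁿ | in_v(I) = lt_>(I)}`. -/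
def leadingCone (o : MonomialOrdering n) (I : Ideal (Mixed n R)) : Set (Fin (n + 1) → ℝ) :=
  closure {v | v 0 < 0 ∧ initialIdeal v I = leadingIdeal o (I : Set (Mixed n R))}

/-- An ideal of `R⟦t⟧[x]` is `x`-homogeneous if it is generated by elements that are homogeneous
as polynomials in `x` over `R⟦t⟧`. -/
def IsXHomogeneous (I : Ideal (Mixed n R)) : Prop :=
  ∃ S : Set (Mixed n R), (∀ f ∈ S, ∃ d : ℕ, f.IsHomogeneous d) ∧ I = Ideal.span S

/-- `G` is a standard basis of `I`: a finite subset of `I` whose leading terms generate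
`lt_>(I)`. -/
def IsStandardBasis (o : MonomialOrdering n) (I : Ideal (Mixed n R))
    (G : Finset (Mixed n R)) : Prop :=
  (G : Set (Mixed n R)) ⊆ (I : Set (Mixed n R)) ∧
    leadingIdeal o (G : Set (Mixed n R)) = leadingIdeal o (I : Set (Mixed n R))

/-- No proper subset of the set of leading terms of `G` generates `lt_>(I)`. -/
def IsMinimal (o : MonomialOrdering n) (I : Ideal (Mixed n R)) (G : Finset (Mixed n R)) : Prop :=
  ∀ T : Set (Poly n R), T ⊂ leadingTerm o '' (G : Set (Mixed n R)) →
    Ideal.span T ≠ leadingIdeal o (I : Set (Mixed n R))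

/-- For `g = ∑ g_α x^α` with `g_α ∈ R⟦t⟧`, the element `g' = ∑ lt_>(g_α) x^α`. -/
def initialPart (o : MonomialOrdering n) (g : Mixed n R) : Mixed n R :=
  ∑ α ∈ g.support,
    toMixed (leadingTerm o (MvPolynomial.C (g.coeff α))) * MvPolynomial.monomial α 1

/-- `G` is reduced w.r.t. `H`: no term of the tail of an element of `G` lies in the ideal generated
by the leading terms of `H`. -/
def IsReducedWrt (o : MonomialOrdering n) (G H : Set (Mixed n R)) : Prop :=
  ∀ g ∈ G, ∀ m ∈ msupport (tail o g),
    MvPolynomial.monomial m (mcoeff m (tail o g)) ∉ leadingIdeal o H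

/-- `G` is initially reduced w.r.t. `H`: `{g' | g ∈ G}` is reduced w.r.t. `H`. -/
def IsInitiallyReducedWrt (o : MonomialOrdering n) (G H : Set (Mixed n R)) : Prop :=
  IsReducedWrt o (initialPart o '' G) H

/-- Initially reduced standard bases. -/
def IsInitiallyReducedStandardBasis (o : MonomialOrdering n) (I : Ideal (Mixed n R))
    (G : Finset (Mixed n R)) : Prop :=
  IsStandardBasis o I G ∧ IsMinimal o I G ∧
    IsInitiallyReducedWrt o (G : Set (Mixed n R)) (G : Set (Mixed n R))

/-! Well-posedness of the definitions above. -/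

theorem toMixed_monomial (m : Mon n) (c : R) :
    toMixed (MvPolynomial.monomial m c) =
      MvPolynomial.monomial m.tail (PowerSeries.monomial (m 0) c) := by
  rw [toMixed, MvPolynomial.aeval_monomial, Finsupp.prod_fintype _ _ (fun i => pow_zero _),
    Fin.prod_univ_succ]
  simp only [Fin.cons_zero, Fin.cons_succ]
  have h1 : (MvPolynomial.monomial m.tail (PowerSeries.monomial (m 0) c) : Mixed n R) =
      MvPolynomial.C (PowerSeries.monomial (m 0) c) *
        ∏ i : Fin n, MvPolynomial.X i ^ (m.tail i) := by
    rw [MvPolynomial.monomial_eq, Finsupp.prod_fintype _ _ (fun i => pow_zero _)]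
  rw [h1, ← mul_assoc]
  congr 1
  rw [← map_pow, MvPolynomial.algebraMap_apply, ← map_mul]
  congr 1
  rw [PowerSeries.monomial_eq_mk, PowerSeries.algebraMap_apply, Algebra.algebraMap_self_apply]
  ext k
  simp [PowerSeries.coeff_X_pow]

theorem mcoeff_toMixed (m : Mon n) (p : Poly n R) :
    mcoeff m (toMixed p) = MvPolynomial.coeff m p := by
  classical
  induction p using MvPolynomial.induction_on' with
  | monomial u a =>
    rw [toMixed_monomial, mcoeff, MvPolynomial.coeff_monomial, MvPolynomial.coeff_monomial]
    by_cases h : u = m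
    · simp [h]
    · rw [if_neg h]
      split_ifs with ht
      · rw [PowerSeries.coeff_monomial, if_neg]
        intro h0
        apply h
        rw [← Finsupp.cons_tail u, ← Finsupp.cons_tail m, ht, h0]
      · simp
  | add p q hp hq =>
    rw [map_add, MvPolynomial.coeff_add, ← hp, ← hq]
    simp [mcoeff]

/-- The lowest powers of `t` in front of the finitely many `x ^ α` occurring in `f`. -/
theorem exists_finset_lowest (f : Mixed n R) :
    ∃ L : Finset (Mon n), (L : Set (Mon n)) ⊆ msupport f ∧
      ∀ m ∈ msupport f, ∃ l ∈ L, ∃ k : ℕ, m = l + Finsupp.single 0 k := by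
  classical
  refine ⟨f.support.image
    (fun α => Finsupp.cons (PowerSeries.order (MvPolynomial.coeff α f)).toNat α), ?_, ?_⟩
  · intro m hm
    simp only [Finset.coe_image, Set.mem_image, Finset.mem_coe, MvPolynomial.mem_support_iff] at hm
    obtain ⟨α, hα, rfl⟩ := hm
    simp only [msupport, Set.mem_ofPred_eq, mcoeff, Finsupp.cons_zero, Finsupp.tail_cons]
    exact PowerSeries.coeff_order hα
  · intro m hm
    simp only [msupport, Set.mem_ofPred_eq, mcoeff] at hm
    have hne : MvPolynomial.coeff m.tail f ≠ 0 := by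
      intro h; rw [h] at hm; simp at hm
    refine ⟨_, Finset.mem_image_of_mem _ (MvPolynomial.mem_support_iff.2 hne),
      m 0 - (PowerSeries.order (MvPolynomial.coeff m.tail f)).toNat, ?_⟩
    have hle : (PowerSeries.order (MvPolynomial.coeff m.tail f)).toNat ≤ m 0 :=
      ENat.toNat_le_of_le_natCast (PowerSeries.order_le _ hm)
    ext i
    refine Fin.cases ?_ (fun j => ?_) i
    · simp only [Finsupp.add_apply, Finsupp.cons_zero, Finsupp.single_eq_same]
      omega
    · simp [Finsupp.tail_apply]

theorem msupport_nonempty {f : Mixed n R} (hf : f ≠ 0) : (msupport f).Nonempty := by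
  obtain ⟨α, hα⟩ := MvPolynomial.ne_zero_iff.1 hf
  refine ⟨Finsupp.cons (PowerSeries.order (MvPolynomial.coeff α f)).toNat α, ?_⟩
  simp only [msupport, Set.mem_ofPred_eq, mcoeff, Finsupp.cons_zero, Finsupp.tail_cons]
  exact PowerSeries.coeff_order hα

theorem IsLeadingMonomial.unique {o : MonomialOrdering n} {f : Mixed n R} {m m' : Mon n}
    (h : IsLeadingMonomial o f m) (h' : IsLeadingMonomial o f m') : m = m' := by
  by_contra hne
  exact o.irrefl _ (o.trans _ _ _ (h.2 m' h'.1 (Ne.symm hne)) (h'.2 m h.1 hne))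

theorem IsLeadingMonomial.leadingTerm_eq {o : MonomialOrdering n} {f : Mixed n R} {m : Mon n}
    (h : IsLeadingMonomial o f m) :
    leadingTerm o f = MvPolynomial.monomial m (mcoeff m f) := by
  have hex : ∃ m, IsLeadingMonomial o f m := ⟨m, h⟩
  rw [leadingTerm, dif_pos hex, hex.choose_spec.unique h]

theorem MonomialOrdering.exists_greatest (o : MonomialOrdering n) {L : Finset (Mon n)}
    (hL : L.Nonempty) : ∃ m ∈ L, ∀ m' ∈ L, m' ≠ m → o.gt m m' := by
  classical
  induction hL using Finset.Nonempty.cons_induction with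
  | singleton a => exact ⟨a, by simp, by simp⟩
  | cons a s ha hs ih =>
    obtain ⟨m, hm, hmax⟩ := ih
    have hne : a ≠ m := fun h => ha (h ▸ hm)
    rcases o.total a m hne with h | h
    · refine ⟨a, by simp, fun m' hm' hne' => ?_⟩
      rcases Finset.mem_cons.1 hm' with rfl | hm'
      · exact absurd rfl hne'
      · by_cases h2 : m' = m
        · exact h2 ▸ h
        · exact o.trans _ _ _ h (hmax m' hm' h2)
    · refine ⟨m, by simp [hm], fun m' hm' hne' => ?_⟩
      rcases Finset.mem_cons.1 hm' with rfl | hm'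
      · exact h
      · exact hmax m' hm' hne'

theorem MonomialOrdering.IsTLocal.gt_add {o : MonomialOrdering n} (ho : o.IsTLocal) (m : Mon n) :
    ∀ k : ℕ, k ≠ 0 → o.gt m (m + Finsupp.single 0 k) := by
  have h1 : ∀ m : Mon n, o.gt m (m + Finsupp.single 0 1) := fun m => by
    simpa [add_comm] using o.add_right _ _ m ho
  intro k hk
  induction k with
  | zero => exact absurd rfl hk
  | succ k ih =>
    rw [Finsupp.single_add, ← add_assoc]
    by_cases hk0 : k = 0
    · subst hk0
      simpa using h1 m
    · exact o.trans _ _ _ (ih hk0) (h1 _)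

theorem exists_isLeadingMonomial {o : MonomialOrdering n} (ho : o.IsTLocal) {f : Mixed n R}
    (hf : f ≠ 0) : ∃ m, IsLeadingMonomial o f m := by
  obtain ⟨L, hLs, hL⟩ := exists_finset_lowest f
  obtain ⟨m₀, hm₀⟩ := msupport_nonempty hf
  obtain ⟨l₀, hl₀, -⟩ := hL m₀ hm₀
  obtain ⟨m, hm, hmax⟩ := o.exists_greatest ⟨l₀, hl₀⟩
  refine ⟨m, hLs hm, fun m' hm' hne => ?_⟩
  obtain ⟨l, hl, k, rfl⟩ := hL m' hm'
  by_cases hk : k = 0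
  · subst hk
    rw [Finsupp.single_zero, add_zero] at hne ⊢
    exact hmax l hl hne
  · by_cases hlm : l = m
    · exact hlm ▸ ho.gt_add l k hk
    · exact o.trans _ _ _ (hmax l hl hlm) (ho.gt_add l k hk)

theorem wdeg_add_single (w : Fin (n + 1) → ℝ) (m : Mon n) (k : ℕ) :
    wdeg w (m + Finsupp.single 0 k) = wdeg w m + w 0 * k := by
  simp [wdeg, Fin.sum_univ_succ, mul_add]
  ring

theorem initialSupport_finite {w : Fin (n + 1) → ℝ} (hw : w 0 < 0) (f : Mixed n R) :
    (initialSupport w f).Finite := by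
  obtain ⟨L, hLs, hL⟩ := exists_finset_lowest f
  refine L.finite_toSet.subset ?_
  rintro m ⟨hm, hmax⟩
  obtain ⟨l, hl, k, rfl⟩ := hL m hm
  have h := hmax l (hLs hl)
  rw [wdeg_add_single] at h
  have hk : k = 0 := by
    by_contra hk
    have hk' : (0 : ℝ) < k := by exact_mod_cast Nat.pos_of_ne_zero hk
    nlinarith
  subst hk
  simpa using hl

open Classical in
theorem coeff_initialForm {w : Fin (n + 1) → ℝ} (hw : w 0 < 0) (f : Mixed n R) (m : Mon n) :
    MvPolynomial.coeff m (initialForm w f) = if m ∈ initialSupport w f then mcoeff m f else 0 := by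
  rw [initialForm, finsum_mem_eq_finite_toFinset_sum _ (initialSupport_finite hw f),
    MvPolynomial.coeff_sum]
  simp [MvPolynomial.coeff_monomial]

end

end GroebnerFan

namespace GroebnerFan

noncomputable section

variable {n : ℕ} {R : Type*} [CommRing R]

/-! ### Coefficients -/

/-! Call a term of `g` lowest if it carries the least power of `t` in front of its `x ^ α`. Initial
reducedness says that the only lowest term of `g ∈ G` in `lt(I)` is `lt(g)` (`eq_of_monomial_mem`).
As `v 0 < 0`, all terms of `in_v(g)` are lowest. So `in_v(I) = lt(I)` forces `lt(g)` to have maximal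
weight in `g`; this is a closed condition on `v`, hence holds for `w`.

For every weight with this property, `G` keeps its leading terms under the ordering that compares
weights first and breaks ties by `o`. In a fixed degree in `x` only finitely many monomials exceed a
given one, so division converges `t`-adically, and the limit stays in `I` by Krull's intersection
theorem (`exists_remainder`). A remainder in `I` without terms in `lt(I)` is zero. It follows that
leading terms of elements of `in_w(I)` lie in `lt(I)` (`monomial_mem_of_mem_initialIdeal`) and that
the forms `in_w(g)` generate `in_w(I)` (`initialIdeal_eq_span`).

If the forms agree, `v` also gives every `lt(g)` maximal weight, and both ideals have the same
generators. If the ideals agree, the leading term of `in_v(g)` lies in `lt(I)`, so it is `lt(g)`. A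
nonzero difference `in_v(g) - in_w(g)` would have as leading term, up to sign, a lowest term of `g`
in `lt(I)`, that is `lt(g)`; but that term cancels. -/

@[simp] theorem mcoeff_zero (m : Mon n) : mcoeff m (0 : Mixed n R) = 0 := by simp [mcoeff]

@[simp] theorem mcoeff_add (m : Mon n) (f g : Mixed n R) :
    mcoeff m (f + g) = mcoeff m f + mcoeff m g := by simp [mcoeff]

@[simp] theorem mcoeff_sub (m : Mon n) (f g : Mixed n R) :
    mcoeff m (f - g) = mcoeff m f - mcoeff m g := by simp [mcoeff]

theorem mcoeff_sum {ι : Type*} (s : Finset ι) (m : Mon n) (f : ι → Mixed n R) :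
    mcoeff m (∑ i ∈ s, f i) = ∑ i ∈ s, mcoeff m (f i) := by
  simp [mcoeff, MvPolynomial.coeff_sum]

theorem ext_mcoeff {f g : Mixed n R} (h : ∀ m, mcoeff m f = mcoeff m g) : f = g := by
  refine MvPolynomial.ext _ _ fun α => PowerSeries.ext fun k => ?_
  simpa [mcoeff] using h (Finsupp.cons k α)

theorem mem_msupport {m : Mon n} {f : Mixed n R} : m ∈ msupport f ↔ mcoeff m f ≠ 0 := Iff.rfl

theorem tail_add (a b : Mon n) : (a + b).tail = a.tail + b.tail := by
  ext i; simp [Finsupp.tail_apply]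

theorem mcoeff_monomial_mul_of_not_le {u m : Mon n} (h : ¬ u ≤ m) (a : R) (f : Mixed n R) :
    mcoeff m (toMixed (MvPolynomial.monomial u a) * f) = 0 := by
  classical
  rw [toMixed_monomial, mcoeff, MvPolynomial.coeff_monomial_mul']
  split_ifs with ht
  · rw [PowerSeries.coeff_mul]
    refine Finset.sum_eq_zero fun p hp => ?_
    rw [PowerSeries.coeff_monomial, if_neg, zero_mul]
    intro h0
    refine h fun i => ?_
    refine Fin.cases ?_ (fun j => ht j) i
    rw [← h0]
    exact Finset.HasAntidiagonal.antidiagonal.fst_le hp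
  · simp

theorem mcoeff_monomial_mul (u m : Mon n) (a : R) (f : Mixed n R) :
    mcoeff (u + m) (toMixed (MvPolynomial.monomial u a) * f) = a * mcoeff m f := by
  classical
  rw [toMixed_monomial, mcoeff, tail_add, MvPolynomial.coeff_monomial_mul, PowerSeries.coeff_mul,
    Finset.sum_eq_single (u 0, m 0)]
  · simp [mcoeff]
  · rintro ⟨i, j⟩ hp hne
    rw [PowerSeries.coeff_monomial, if_neg, zero_mul]
    rintro rfl
    apply hne
    simp at hp
    simp [hp]
  · intro h
    simp at h

theorem exists_of_mem_msupport_monomial_mul {u m : Mon n} {a : R} {f : Mixed n R}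
    (h : m ∈ msupport (toMixed (MvPolynomial.monomial u a) * f)) :
    ∃ m' ∈ msupport f, m = u + m' := by
  by_cases hu : u ≤ m
  · obtain ⟨m', rfl⟩ := exists_add_of_le hu
    refine ⟨m', fun h0 => h ?_, rfl⟩
    rw [mcoeff_monomial_mul, h0, mul_zero]
  · exact absurd (mcoeff_monomial_mul_of_not_le hu a f) h

theorem mem_or_mem_of_mem_msupport_add {m : Mon n} {f g : Mixed n R}
    (h : m ∈ msupport (f + g)) : m ∈ msupport f ∨ m ∈ msupport g := by
  by_contra! hc
  simp only [mem_msupport, not_not] at hc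
  exact h (by simp [hc.1, hc.2])

theorem mem_or_mem_of_mem_msupport_sub {m : Mon n} {f g : Mixed n R}
    (h : m ∈ msupport (f - g)) : m ∈ msupport f ∨ m ∈ msupport g := by
  by_contra! hc
  simp only [mem_msupport, not_not] at hc
  exact h (by simp [hc.1, hc.2])

/-! ### Degrees in `x` -/

/-- The degree of `t ^ β * x ^ α` in `x`. -/
def xdeg (m : Mon n) : ℕ := m.tail.degree

theorem xdeg_add (a b : Mon n) : xdeg (a + b) = xdeg a + xdeg b := by
  simp [xdeg, tail_add]

theorem xdeg_single_zero (k : ℕ) : xdeg (Finsupp.single 0 k : Mon n) = 0 := by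
  have : (Finsupp.single 0 k : Mon n).tail = 0 := by
    ext i; simp [Finsupp.tail_apply]
  simp [xdeg, this]

theorem apply_succ_le_xdeg (m : Mon n) (i : Fin n) : m i.succ ≤ xdeg m :=
  Finsupp.le_degree i m.tail

/-- All monomials of `f` have degree `d` in `x`. -/
def IsXForm (d : ℕ) (f : Mixed n R) : Prop := ∀ m ∈ msupport f, xdeg m = d

theorem isXForm_iff {d : ℕ} {f : Mixed n R} : IsXForm d f ↔ f.IsHomogeneous d := by
  constructor
  · intro h α hα
    obtain ⟨k, hk⟩ : ∃ k, PowerSeries.coeff k (f.coeff α) ≠ 0 := by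
      by_contra! hc
      exact hα (PowerSeries.ext (by simpa using hc))
    have := h (Finsupp.cons k α) (by simpa [msupport, mcoeff] using hk)
    simpa [xdeg, Finsupp.degree_eq_weight_one, ← Pi.one_def] using this
  · intro h m hm
    have : f.coeff m.tail ≠ 0 := fun h0 => hm (by simp [mcoeff, h0])
    simpa [xdeg, Finsupp.degree_eq_weight_one, ← Pi.one_def] using h this

theorem isXForm_zero (d : ℕ) : IsXForm d (0 : Mixed n R) := fun m hm => absurd (mcoeff_zero m) hm

theorem IsXForm.add {d : ℕ} {f g : Mixed n R} (hf : IsXForm d f) (hg : IsXForm d g) :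
    IsXForm d (f + g) := fun m hm =>
  (mem_or_mem_of_mem_msupport_add hm).elim (hf m) (hg m)

theorem IsXForm.sub {d : ℕ} {f g : Mixed n R} (hf : IsXForm d f) (hg : IsXForm d g) :
    IsXForm d (f - g) := fun m hm =>
  (mem_or_mem_of_mem_msupport_sub hm).elim (hf m) (hg m)

theorem isXForm_sum {ι : Type*} {d : ℕ} (s : Finset ι) {f : ι → Mixed n R}
    (h : ∀ i ∈ s, IsXForm d (f i)) : IsXForm d (∑ i ∈ s, f i) :=
  isXForm_iff.2 (MvPolynomial.IsHomogeneous.sum _ _ _ fun i hi => isXForm_iff.1 (h i hi))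

theorem IsXForm.monomial_mul {d : ℕ} {f : Mixed n R} (hf : IsXForm d f) (u : Mon n) (a : R) :
    IsXForm (xdeg u + d) (toMixed (MvPolynomial.monomial u a) * f) := by
  intro m hm
  obtain ⟨m', hm', rfl⟩ := exists_of_mem_msupport_monomial_mul hm
  rw [xdeg_add, hf m' hm']

theorem mcoeff_homogeneousComponent (d : ℕ) (f : Mixed n R) (m : Mon n) :
    mcoeff m (MvPolynomial.homogeneousComponent d f) = if xdeg m = d then mcoeff m f else 0 := by
  rw [mcoeff, MvPolynomial.coeff_homogeneousComponent]
  split_ifs with h1 h2 h2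
  · rfl
  · exact absurd h1 h2
  · exact absurd h2 h1
  · simp

theorem isXForm_homogeneousComponent (d : ℕ) (f : Mixed n R) :
    IsXForm d (MvPolynomial.homogeneousComponent d f) :=
  isXForm_iff.2 (MvPolynomial.homogeneousComponent_isHomogeneous d f)

theorem IsXHomogeneous.homogeneousComponent_mem {I : Ideal (Mixed n R)} (hI : IsXHomogeneous I)
    {f : Mixed n R} (hf : f ∈ I) (d : ℕ) : MvPolynomial.homogeneousComponent d f ∈ I := by
  obtain ⟨S, hS, rfl⟩ := hI
  let _ : GradedAlgebra (MvPolynomial.homogeneousSubmodule (Fin n) (PowerSeries R)) :=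
    MvPolynomial.gradedAlgebra
  refine MvPolynomial.homogeneousComponent_mem_of_mem
    (Ideal.homogeneous_span _ S fun x hx => ?_) hf d
  obtain ⟨d, hd⟩ := hS x hx
  exact ⟨d, hd⟩

/-- Only finitely many `x ^ α` have degree `d`, and power series coefficients are arbitrary. This
builds limits coefficient by coefficient. -/
theorem exists_mcoeff_eq (d : ℕ) (e : Mon n → R) :
    ∃ f : Mixed n R, IsXForm d f ∧ ∀ m, xdeg m = d → mcoeff m f = e m := by
  classical
  have hfin : {α : Fin n →₀ ℕ | α.degree = d}.Finite :=
    (Finsupp.finite_of_degree_le d).subset fun α hα => le_of_eq hα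
  have key : ∀ m : Mon n, mcoeff m (∑ α ∈ hfin.toFinset,
      MvPolynomial.monomial α (PowerSeries.mk fun k => e (Finsupp.cons k α)) : Mixed n R) =
      if xdeg m = d then e m else 0 := by
    intro m
    rw [mcoeff, MvPolynomial.coeff_sum]
    simp only [MvPolynomial.coeff_monomial, Finset.sum_ite_eq', Set.Finite.mem_toFinset,
      Set.mem_ofPred_eq, xdeg]
    by_cases h : m.tail.degree = d <;> simp [h]
  refine ⟨_, fun m hm => ?_, fun m hm => (key m).trans (if_pos hm)⟩
  by_contra hne
  exact hm ((key m).trans (if_neg hne))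

/-! ### `t`-adic closedness of the graded pieces of ideals -/

/-- Krull's intersection theorem in the quotient of `M` by `N ∩ M`: the class of `r` is divisible by
every power of `x`. -/
theorem mem_of_forall_sub_pow_smul_mem {A P : Type*} [CommRing A] [IsNoetherianRing A]
    [AddCommGroup P] [Module A P] {M N : Submodule A P} (hM : M.FG) {x : A}
    (hx : x ∈ Ideal.jacobson (⊥ : Ideal A)) {r : P} (hr : r ∈ M)
    (h : ∀ K : ℕ, ∃ q ∈ M, r - x ^ K • q ∈ N) : r ∈ N := by
  have : Module.Finite A M := Module.Finite.iff_fg.2 hM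
  let N' : Submodule A M := N.comap M.subtype
  have hkrull := Ideal.iInf_pow_smul_eq_bot_of_le_jacobson (M := M ⧸ N') (Ideal.span {x})
    (by rwa [Ideal.span_le, Set.singleton_subset_iff])
  have hmem : N'.mkQ ⟨r, hr⟩ ∈
      (⨅ i : ℕ, Ideal.span {x} ^ i • ⊤ : Submodule A (M ⧸ N')) := by
    rw [Submodule.mem_iInf]
    intro K
    obtain ⟨q, hq, hqN⟩ := h K
    have : N'.mkQ ⟨r, hr⟩ = x ^ K • N'.mkQ ⟨q, hq⟩ := by
      rw [← map_smul, Submodule.mkQ_apply, Submodule.mkQ_apply, Submodule.Quotient.eq]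
      exact hqN
    rw [this]
    exact Submodule.smul_mem_smul (Ideal.pow_mem_pow (Ideal.mem_span_singleton_self _) K)
      Submodule.mem_top
  rw [hkrull, Submodule.mem_bot, Submodule.mkQ_apply, Submodule.Quotient.mk_eq_zero] at hmem
  exact hmem

theorem X_pow_smul_eq (K : ℕ) (q : Mixed n R) :
    (PowerSeries.X ^ K : PowerSeries R) • q =
      toMixed (MvPolynomial.monomial (Finsupp.single 0 K) 1) * q := by
  have : (Finsupp.single 0 K : Mon n).tail = 0 := by
    ext i; simp [Finsupp.tail_apply]
  rw [toMixed_monomial, MvPolynomial.smul_eq_C_mul, this, Finsupp.single_eq_same,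
    PowerSeries.X_pow_eq]
  rfl

/-- The forms of degree `d` are a finitely generated module over `R⟦t⟧`, and `t` lies in the
Jacobson radical; agreement below `t ^ K` means congruence modulo `t ^ K`. -/
theorem mem_of_forall_exists_mcoeff_eq [IsNoetherianRing R] {I : Ideal (Mixed n R)} {d : ℕ}
    {r : Mixed n R} (hr : IsXForm d r)
    (h : ∀ K : ℕ, ∃ g ∈ I, IsXForm d g ∧ ∀ m, m 0 < K → mcoeff m g = mcoeff m r) : r ∈ I := by
  have hjac : (PowerSeries.X : PowerSeries R) ∈ Ideal.jacobson (⊥ : Ideal (PowerSeries R)) := by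
    rw [Ideal.mem_jacobson_bot]
    intro y
    rw [PowerSeries.isUnit_iff_constantCoeff]
    simp
  refine mem_of_forall_sub_pow_smul_mem (N := I.restrictScalars (PowerSeries R))
    (MvPolynomial.homogeneousSubmodule_fg (Fin n) (PowerSeries R) d) hjac (isXForm_iff.1 hr)
    fun K => ?_
  obtain ⟨g, hgI, hg, hgr⟩ := h K
  -- `q` is the quotient of `r - g` by `t ^ K`, obtained by shifting coefficients.
  obtain ⟨q, hq, hqe⟩ := exists_mcoeff_eq d fun m => mcoeff (Finsupp.single 0 K + m) (r - g)
  refine ⟨q, isXForm_iff.1 hq, ?_⟩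
  have hX : (PowerSeries.X ^ K : PowerSeries R) • q = r - g := by
    rw [X_pow_smul_eq]
    refine ext_mcoeff fun m => ?_
    by_cases hm : Finsupp.single 0 K ≤ m
    · obtain ⟨m', rfl⟩ := exists_add_of_le hm
      rw [mcoeff_monomial_mul, one_mul]
      by_cases hd : xdeg m' = d
      · exact hqe m' hd
      · have h1 : mcoeff m' q = 0 := by
          by_contra h0; exact hd (hq m' h0)
        have h2 : mcoeff (Finsupp.single 0 K + m') (r - g) = 0 := by
          by_contra h0
          have := hr.sub hg _ h0
          rw [xdeg_add, xdeg_single_zero, zero_add] at this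
          exact hd this
        rw [h1, h2]
    · rw [mcoeff_monomial_mul_of_not_le hm, mcoeff_sub, hgr, sub_self]
      by_contra! hc
      exact hm (by simpa using hc)
  rw [hX, sub_sub_cancel]
  exact hgI

/-! ### Weights and weighted orderings -/

theorem wdeg_add (v : Fin (n + 1) → ℝ) (a b : Mon n) : wdeg v (a + b) = wdeg v a + wdeg v b := by
  simp [wdeg, mul_add, Finset.sum_add_distrib]

/-- Comparing weights first and breaking ties with `o`. -/
def MonomialOrdering.weighted (o : MonomialOrdering n) (v : Fin (n + 1) → ℝ) :
    MonomialOrdering n where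
  gt a b := wdeg v b < wdeg v a ∨ (wdeg v a = wdeg v b ∧ o.gt a b)
  irrefl a h := h.elim (lt_irrefl _) fun h => o.irrefl a h.2
  trans a b c h1 h2 := by
    rcases h1 with h1 | h1 <;> rcases h2 with h2 | h2
    · exact Or.inl (h2.trans h1)
    · exact Or.inl (h2.1 ▸ h1)
    · exact Or.inl (h1.1 ▸ h2)
    · exact Or.inr ⟨h1.1.trans h2.1, o.trans _ _ _ h1.2 h2.2⟩
  total a b h := by
    rcases lt_trichotomy (wdeg v a) (wdeg v b) with h1 | h1 | h1
    · exact Or.inr (Or.inl h1)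
    · exact (o.total a b h).imp (fun h2 => Or.inr ⟨h1, h2⟩) fun h2 => Or.inr ⟨h1.symm, h2⟩
    · exact Or.inl (Or.inl h1)
  add_right a b c h := by
    simp only [wdeg_add]
    exact h.imp (fun h => by linarith) fun h => ⟨by linarith [h.1], o.add_right _ _ _ h.2⟩

/-- In a fixed degree in `x` the weight is `v 0 * m 0` up to a bounded error, so for `v 0 < 0` it
tends to `-∞` with the exponent of `t`. -/
theorem abs_wdeg_sub_le (v : Fin (n + 1) → ℝ) (m : Mon n) :
    |wdeg v m - v 0 * m 0| ≤ (∑ i : Fin n, |v i.succ|) * xdeg m := by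
  rw [wdeg, Fin.sum_univ_succ, add_sub_cancel_left, Finset.sum_mul]
  refine (Finset.abs_sum_le_sum_abs _ _).trans (Finset.sum_le_sum fun i _ => ?_)
  rw [abs_mul, Nat.abs_cast]
  exact mul_le_mul_of_nonneg_left (by exact_mod_cast apply_succ_le_xdeg m i) (abs_nonneg _)

theorem finite_xdeg_eq_le_wdeg {v : Fin (n + 1) → ℝ} (hv : v 0 < 0) (d : ℕ) (c : ℝ) :
    {m : Mon n | xdeg m = d ∧ c ≤ wdeg v m}.Finite := by
  obtain ⟨B, hB⟩ := exists_nat_ge (((∑ i : Fin n, |v i.succ|) * d - c) / (-v 0))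
  refine (Set.finite_Iic (Finsupp.equivFunOnFinite.symm fun _ => max B d : Mon n)).subset ?_
  rintro m ⟨hd, hc⟩ i
  refine Fin.cases ?_ (fun j => ?_) i
  · refine le_max_of_le_left ?_
    have h := (le_abs_self _).trans (abs_wdeg_sub_le v m)
    rw [hd] at h
    have : (m 0 : ℝ) ≤ B := by
      refine le_trans ?_ hB
      rw [le_div_iff₀ (by linarith)]
      linarith
    exact_mod_cast this
  · exact le_max_of_le_right (hd ▸ apply_succ_le_xdeg m j)

/-- In a fixed degree in `x`, the monomials with small exponent of `t` are contained in a finite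
set that is closed under passing to larger monomials. -/
def MonomialOrdering.HasFiniteUpperSets (o : MonomialOrdering n) : Prop :=
  ∀ d K : ℕ, ∃ D : Finset (Mon n), (∀ m ∈ D, xdeg m = d) ∧ (∀ m, xdeg m = d → m 0 < K → m ∈ D) ∧
    ∀ m ∈ D, ∀ m', xdeg m' = d → o.gt m' m → m' ∈ D

/-- This is the gain from weighting: `o` itself may place infinitely many `x₁ * t ^ k` above `x₂`.
-/
theorem MonomialOrdering.hasFiniteUpperSets_weighted (o : MonomialOrdering n)
    {v : Fin (n + 1) → ℝ} (hv : v 0 < 0) : (o.weighted v).HasFiniteUpperSets := by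
  intro d K
  -- The threshold is a lower bound for the weights of all monomials of degree `d` with exponent of
  -- `t` at most `K`.
  have hfin := finite_xdeg_eq_le_wdeg hv d (v 0 * K - (∑ i : Fin n, |v i.succ|) * d)
  refine ⟨hfin.toFinset, fun m hm => ((hfin.mem_toFinset).1 hm).1, fun m hd hK => ?_,
    fun m hm m' hd hgt => ?_⟩
  · refine (hfin.mem_toFinset).2 ⟨hd, ?_⟩
    have h := neg_abs_le (wdeg v m - v 0 * m 0)
    have h2 := abs_wdeg_sub_le v m
    rw [hd] at h2
    have hK' : (m 0 : ℝ) ≤ K := by exact_mod_cast hK.le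
    nlinarith
  · have hm := (hfin.mem_toFinset).1 hm
    refine (hfin.mem_toFinset).2 ⟨hd, hm.2.trans ?_⟩
    exact hgt.elim le_of_lt fun h => h.1.ge

/-! ### Top forms -/

/-- No term of `f` has weight greater than `W`, and `p` is the sum of the terms of weight `W`. -/
def HasTopForm (v : Fin (n + 1) → ℝ) (W : ℝ) (f : Mixed n R) (p : Poly n R) : Prop :=
  (∀ m ∈ msupport f, wdeg v m ≤ W) ∧ (∀ m, wdeg v m = W → p.coeff m = mcoeff m f) ∧
    ∀ m, wdeg v m ≠ W → p.coeff m = 0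

variable {v : Fin (n + 1) → ℝ}

theorem hasTopForm_zero (W : ℝ) : HasTopForm v W (0 : Mixed n R) 0 :=
  ⟨fun m hm => absurd (mcoeff_zero m) hm, fun m _ => by simp, fun m _ => by simp⟩

/-- The bound `W` need not be attained, so cancellation of top terms is harmless. -/
theorem HasTopForm.add {W : ℝ} {f g : Mixed n R} {p q : Poly n R} (hf : HasTopForm v W f p)
    (hg : HasTopForm v W g q) : HasTopForm v W (f + g) (p + q) :=
  ⟨fun m hm => (mem_or_mem_of_mem_msupport_add hm).elim (hf.1 m) (hg.1 m),
    fun m hm => by rw [MvPolynomial.coeff_add, mcoeff_add, hf.2.1 m hm, hg.2.1 m hm],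
    fun m hm => by rw [MvPolynomial.coeff_add, hf.2.2 m hm, hg.2.2 m hm, add_zero]⟩

theorem HasTopForm.monomial_mul {W : ℝ} {f : Mixed n R} {p : Poly n R} (hf : HasTopForm v W f p)
    (u : Mon n) (a : R) : HasTopForm v (wdeg v u + W)
      (toMixed (MvPolynomial.monomial u a) * f) (MvPolynomial.monomial u a * p) := by
  classical
  refine ⟨fun m hm => ?_, fun m hm => ?_, fun m hm => ?_⟩
  · obtain ⟨m', hm', rfl⟩ := exists_of_mem_msupport_monomial_mul hm
    rw [wdeg_add]
    linarith [hf.1 m' hm']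
  · by_cases hu : u ≤ m
    · obtain ⟨m', rfl⟩ := exists_add_of_le hu
      rw [MvPolynomial.coeff_monomial_mul, mcoeff_monomial_mul, hf.2.1]
      rw [wdeg_add] at hm
      linarith
    · rw [mcoeff_monomial_mul_of_not_le hu, MvPolynomial.coeff_monomial_mul', if_neg hu]
  · by_cases hu : u ≤ m
    · obtain ⟨m', rfl⟩ := exists_add_of_le hu
      rw [MvPolynomial.coeff_monomial_mul, hf.2.2, mul_zero]
      intro h
      exact hm (by rw [wdeg_add, h])
    · rw [MvPolynomial.coeff_monomial_mul', if_neg hu]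

theorem hasTopForm_initialForm (hv : v 0 < 0) {f : Mixed n R} {m : Mon n}
    (hm : m ∈ initialSupport v f) : HasTopForm v (wdeg v m) f (initialForm v f) := by
  classical
  refine ⟨hm.2, fun m' h' => ?_, fun m' h' => ?_⟩ <;> rw [coeff_initialForm hv]
  · split_ifs with h
    · rfl
    · by_contra h0
      exact h ⟨fun h => h0 h.symm, fun m'' hm'' => h'.symm ▸ hm.2 m'' hm''⟩
  · rw [if_neg]
    exact fun h => h' (le_antisymm (hm.2 m' h.1) (h.2 m hm.1))

theorem exists_mem_initialSupport (hv : v 0 < 0) {f : Mixed n R} (hf : f ≠ 0) :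
    ∃ m, m ∈ initialSupport v f := by
  obtain ⟨L, hLs, hL⟩ := exists_finset_lowest f
  obtain ⟨m₀, hm₀⟩ := msupport_nonempty hf
  obtain ⟨l₀, hl₀, -⟩ := hL m₀ hm₀
  obtain ⟨l, hl, hmax⟩ := L.exists_max_image (wdeg v) ⟨l₀, hl₀⟩
  refine ⟨l, hLs hl, fun m' hm' => ?_⟩
  obtain ⟨l', hl', k, rfl⟩ := hL m' hm'
  rw [wdeg_add_single]
  have h1 := hmax l' hl'
  have h2 : (0 : ℝ) ≤ k := k.cast_nonneg
  nlinarith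

variable {o : MonomialOrdering n}

/-! ### Reducing terms modulo a standard basis -/

/-- Some element of `I`, homogeneous in `x`, has the term with monomial `m` and coefficient `c`
as its only term not smaller than `m`, and its terms of weight `wdeg v m` sum up to an element
of `J`. -/
def HasReducer (o : MonomialOrdering n) (v : Fin (n + 1) → ℝ) (I : Ideal (Mixed n R))
    (J : Ideal (Poly n R)) (m : Mon n) (c : R) : Prop :=
  ∃ s ∈ I, IsXForm (xdeg m) s ∧ mcoeff m s = c ∧ (∀ m' ∈ msupport s, m' ≠ m → o.gt m m') ∧
    ∃ p ∈ J, HasTopForm v (wdeg v m) s p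

variable {I : Ideal (Mixed n R)} {J : Ideal (Poly n R)}

/-- The coefficient zero is admitted because coefficients may cancel in sums, or vanish in products
when `R` has zero divisors. -/
theorem hasReducer_zero (m : Mon n) : HasReducer o v I J m 0 :=
  ⟨0, I.zero_mem, isXForm_zero _, mcoeff_zero m, fun m' hm' => absurd (mcoeff_zero m') hm', 0,
    J.zero_mem, hasTopForm_zero _⟩

theorem HasReducer.add {m : Mon n} {c c' : R} (h : HasReducer o v I J m c)
    (h' : HasReducer o v I J m c') : HasReducer o v I J m (c + c') := by
  obtain ⟨s, hs, hd, rfl, hlt, p, hp, hsp⟩ := h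
  obtain ⟨s', hs', hd', rfl, hlt', p', hp', hsp'⟩ := h'
  exact ⟨s + s', I.add_mem hs hs', hd.add hd', mcoeff_add m s s',
    fun m' hm' => (mem_or_mem_of_mem_msupport_add hm').elim (hlt m') (hlt' m'),
    p + p', J.add_mem hp hp', hsp.add hsp'⟩

theorem HasReducer.monomial_mul {m : Mon n} {c : R} (h : HasReducer o v I J m c) (u : Mon n)
    (a : R) : HasReducer o v I J (u + m) (a * c) := by
  obtain ⟨s, hs, hd, rfl, hlt, p, hp, hsp⟩ := h
  refine ⟨_, I.mul_mem_left _ hs, xdeg_add u m ▸ hd.monomial_mul u a, mcoeff_monomial_mul u m a s,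
    fun m' hm' hne => ?_, _, J.mul_mem_left _ hp, wdeg_add v u m ▸ hsp.monomial_mul u a⟩
  obtain ⟨m'', hm'', rfl⟩ := exists_of_mem_msupport_monomial_mul hm'
  rw [add_comm u, add_comm u]
  exact o.add_right _ _ _ (hlt m'' hm'' fun h => hne (by rw [h]))

theorem hasReducer_coeff_mul {h : Poly n R} (hh : ∀ m, HasReducer o v I J m (h.coeff m))
    (p : Poly n R) (m : Mon n) : HasReducer o v I J m ((p * h).coeff m) := by
  classical
  induction p using MvPolynomial.induction_on' with
  | monomial u a =>
    by_cases hu : u ≤ m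
    · obtain ⟨m', rfl⟩ := exists_add_of_le hu
      rw [MvPolynomial.coeff_monomial_mul]
      exact (hh m').monomial_mul u a
    · rw [MvPolynomial.coeff_monomial_mul', if_neg hu]
      exact hasReducer_zero m
  | add p q hp hq =>
    rw [add_mul, MvPolynomial.coeff_add]
    exact hp.add hq

/-! ### Bases whose leading terms are selected by the weight -/

theorem leadingTerm_zero (o : MonomialOrdering n) : leadingTerm o (0 : Mixed n R) = 0 := by
  rw [leadingTerm, dif_neg]
  rintro ⟨m, hm, -⟩
  exact hm (mcoeff_zero m)

/-- `v` selects the leading term of `g` with respect to `o`. -/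
def SelectsLeading (o : MonomialOrdering n) (v : Fin (n + 1) → ℝ) (g : Mixed n R) : Prop :=
  ∀ m, IsLeadingMonomial o g m → m ∈ initialSupport v g

theorem SelectsLeading.isLeadingMonomial_weighted {g : Mixed n R} (h : SelectsLeading o v g)
    {m : Mon n} (hm : IsLeadingMonomial o g m) : IsLeadingMonomial (o.weighted v) g m := by
  refine ⟨hm.1, fun m' hm' hne => ?_⟩
  rcases ((h m hm).2 m' hm').lt_or_eq with h1 | h1
  · exact Or.inl h1
  · exact Or.inr ⟨h1.symm, hm.2 m' hm' hne⟩

/-- The hypotheses on a standard basis under which division with respect to the weighted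
ordering works. -/
structure IsAdaptedBasis (o : MonomialOrdering n) (v : Fin (n + 1) → ℝ) (I : Ideal (Mixed n R))
    (G : Set (Mixed n R)) : Prop where
  subset : G ⊆ I
  leadingIdeal_eq : leadingIdeal o G = leadingIdeal o (I : Set (Mixed n R))
  exists_isXForm : ∀ g ∈ G, ∃ d, IsXForm d g
  selectsLeading : ∀ g ∈ G, SelectsLeading o v g

section AdaptedBasis

variable {G : Set (Mixed n R)}

/-- For a generator `lt(g)` the reducer is `g` itself; reducers are stable under sums and multiples,
so they exist throughout the ideal. -/
theorem IsAdaptedBasis.hasReducer (hG : IsAdaptedBasis o v I G) (ho : o.IsTLocal) (hv : v 0 < 0)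
    {h : Poly n R} (hh : h ∈ leadingIdeal o (I : Set (Mixed n R))) (m : Mon n) :
    HasReducer (o.weighted v) v I (Ideal.span (initialForm v '' G)) m (h.coeff m) := by
  classical
  rw [← hG.leadingIdeal_eq] at hh
  induction hh using Submodule.span_induction generalizing m with
  | mem h hh =>
    obtain ⟨g, hg, rfl⟩ := hh
    by_cases hg0 : g = 0
    · rw [hg0, leadingTerm_zero, MvPolynomial.coeff_zero]
      exact hasReducer_zero m
    · obtain ⟨l, hl⟩ := exists_isLeadingMonomial ho hg0
      rw [hl.leadingTerm_eq, MvPolynomial.coeff_monomial]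
      split_ifs with hlm
      · subst hlm
        obtain ⟨d, hd⟩ := hG.exists_isXForm g hg
        refine ⟨g, hG.subset hg, hd l hl.1 ▸ hd, rfl,
          ((hG.selectsLeading g hg).isLeadingMonomial_weighted hl).2, _,
          Ideal.subset_span ⟨g, hg, rfl⟩, hasTopForm_initialForm hv (hG.selectsLeading g hg l hl)⟩
      · exact hasReducer_zero m
  | zero => exact hasReducer_zero m
  | add p q _ _ hp hq => exact (hp m).add (hq m)
  | smul a p _ hp => exact hasReducer_coeff_mul hp a m

/-! ### Convergent division in a fixed degree in `x` -/

theorem MonomialOrdering.HasFiniteUpperSets.exists_above (ho : o.HasFiniteUpperSets) (m : Mon n) :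
    ∃ A : Finset (Mon n), ∀ m', m' ∈ A ↔ xdeg m' = xdeg m ∧ o.gt m' m := by
  classical
  obtain ⟨D, hD1, hD2, hD3⟩ := ho (xdeg m) (m 0 + 1)
  refine ⟨D.filter fun m' => o.gt m' m, fun m' => ?_⟩
  rw [Finset.mem_filter]
  exact ⟨fun h => ⟨hD1 m' h.1, h.2⟩,
    fun h => ⟨hD3 m (hD2 m rfl (Nat.lt_succ_self _)) m' h.1 h.2, h.2⟩⟩

/-- The number of monomials above `m` strictly drops on passing to a larger monomial. -/
theorem MonomialOrdering.HasFiniteUpperSets.wellFounded (ho : o.HasFiniteUpperSets) :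
    WellFounded fun m' m : Mon n => xdeg m' = xdeg m ∧ o.gt m' m := by
  choose A hA using ho.exists_above
  refine Subrelation.wf (r := InvImage (· < ·) fun m => (A m).card) (fun {m' m} h => ?_)
    (InvImage.wf _ wellFounded_lt)
  refine Finset.card_lt_card (Finset.ssubset_iff_of_subset (fun a ha => ?_) |>.2 ⟨m', ?_, ?_⟩)
  · have := (hA m' a).1 ha
    exact (hA m a).2 ⟨this.1.trans h.1, o.trans _ _ _ this.2 h.2⟩
  · exact (hA m m').2 h
  · exact fun h' => o.irrefl m' ((hA m' m').1 h').2

/-- Division with remainder: an infinite reduction process converges `t`-adically to a remainder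
no term of which lies in `L`. -/
theorem exists_remainder [IsNoetherianRing R] (ho : o.HasFiniteUpperSets) {L : Ideal (Poly n R)}
    (hred : ∀ m c, MvPolynomial.monomial m c ∈ L → ∃ s ∈ I, IsXForm (xdeg m) s ∧
      mcoeff m s = c ∧ ∀ m' ∈ msupport s, m' ≠ m → o.gt m m')
    {d : ℕ} {f : Mixed n R} (hf : f ∈ I) (hd : IsXForm d f) :
    ∃ r ∈ I, (∀ m ∈ msupport r, MvPolynomial.monomial m (mcoeff m r) ∉ L) ∧
      ∀ m, IsLeadingMonomial o f m → MvPolynomial.monomial m (mcoeff m f) ∉ L →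
        mcoeff m r = mcoeff m f := by
  classical
  -- Reducers as a total function, with default `0` for irreducible terms. A zero coefficient also
  -- gets `0`, so nothing is subtracted where nothing occurs.
  have hred' : ∀ (m : Mon n) (c : R), ∃ s ∈ I, IsXForm (xdeg m) s ∧
      (∀ m' ∈ msupport s, m' ≠ m → o.gt m m') ∧ (c = 0 → s = 0) ∧
      (MvPolynomial.monomial m c ∈ L → mcoeff m s = c) ∧
      (MvPolynomial.monomial m c ∉ L → s = 0) := by
    intro m c
    by_cases hc : c = 0
    · exact ⟨0, I.zero_mem, isXForm_zero _, fun m' hm' => absurd (mcoeff_zero m') hm',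
        fun _ => rfl, fun _ => by simp [hc], fun _ => rfl⟩
    by_cases hm : MvPolynomial.monomial m c ∈ L
    · obtain ⟨s, hs, hsd, hsc, hlt⟩ := hred m c hm
      exact ⟨s, hs, hsd, hlt, fun h => absurd h hc, fun _ => hsc, fun h => absurd hm h⟩
    · exact ⟨0, I.zero_mem, isXForm_zero _, fun m' hm' => absurd (mcoeff_zero m') hm',
        fun _ => rfl, fun h => absurd h hm, fun _ => rfl⟩
  choose ρ hρI hρd hρlt hρ0 hρL hρnL using hred'
  choose A hA using ho.exists_above
  -- `s m` reduces the term at `m` that remains once the reducers of all larger monomials have been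
  -- subtracted; `c m` is its coefficient.
  let s : Mon n → Mixed n R := ho.wellFounded.fix fun m ih =>
    ρ m (mcoeff m (f - ∑ m' ∈ (A m).attach, ih m' ((hA m m').1 m'.2)))
  let c : Mon n → R := fun m => mcoeff m (f - ∑ m' ∈ A m, s m')
  have hs : ∀ m, s m = ρ m (c m) := by
    intro m
    refine (ho.wellFounded.fix_eq _ m).trans ?_
    congr 2
    exact congrArg _ (Finset.sum_attach (A m) s)
  have hsI : ∀ m, s m ∈ I := fun m => hs m ▸ hρI m _
  have hsd : ∀ m, IsXForm (xdeg m) (s m) := fun m => hs m ▸ hρd m _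
  have hslt : ∀ m, ∀ m' ∈ msupport (s m), m' ≠ m → o.gt m m' := by
    intro m; rw [hs m]; exact hρlt m _
  -- After step `m` the coefficient at `m` is final, since later reducers involve only smaller
  -- monomials.
  obtain ⟨r, hrd, hr⟩ := exists_mcoeff_eq d fun m => c m - mcoeff m (s m)
  have hrI : r ∈ I := by
    refine mem_of_forall_exists_mcoeff_eq hrd fun K => ?_
    -- As `D` is closed upwards, subtracting the reducers from `D` alone already gives the final
    -- coefficients on `D`, in particular below `t ^ K`.
    obtain ⟨D, hD1, hD2, hD3⟩ := ho d K
    have hgd : IsXForm d (f - ∑ m ∈ D, s m) :=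
      hd.sub (isXForm_sum D fun m hm => hD1 m hm ▸ hsd m)
    refine ⟨f - ∑ m ∈ D, s m, I.sub_mem hf (I.sum_mem fun m _ => hsI m), hgd, fun m hm => ?_⟩
    by_cases hmd : xdeg m = d
    · have hmD := hD2 m hmd hm
      have hmA : m ∉ A m := fun h => o.irrefl m ((hA m m).1 h).2
      rw [hr m hmd]
      change _ = mcoeff m (f - ∑ m' ∈ A m, s m') - _
      rw [mcoeff_sub, mcoeff_sub, mcoeff_sum, mcoeff_sum, sub_sub, add_comm (∑ _ ∈ _, _),
        ← Finset.sum_insert (f := fun i => mcoeff m (s i)) hmA]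
      congr 1
      symm
      refine Finset.sum_subset (fun m' hm' => ?_) fun m' hm' hnot => ?_
      · rcases Finset.mem_insert.1 hm' with rfl | hm'
        · exact hmD
        · have := (hA m m').1 hm'
          exact hD3 m hmD m' (this.1.trans hmd) this.2
      · by_contra h0
        rw [Finset.mem_insert, hA, not_or] at hnot
        exact hnot.2 ⟨(hD1 m' hm').trans hmd.symm, hslt m' m h0 fun h => hnot.1 h.symm⟩
    · have h1 : mcoeff m r = 0 := by
        by_contra h0; exact hmd (hrd m h0)
      rw [h1]
      by_contra h0; exact hmd (hgd m h0)
  refine ⟨r, hrI, fun m hm hmL => ?_, fun m hm hmL => ?_⟩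
  · rw [hr m (hrd m hm), hs m] at hmL
    refine hm ?_
    rw [hr m (hrd m hm), hs m]
    by_cases h : MvPolynomial.monomial m (c m) ∈ L
    · rw [hρL m _ h, sub_self]
    · rw [hρnL m _ h, mcoeff_zero, sub_zero] at hmL
      exact absurd hmL h
  · have hs0 : ∀ m', o.gt m' m → s m' = 0 := by
      intro m'
      induction m' using ho.wellFounded.induction with
      | _ m' ih =>
        intro hgt
        rw [hs m']
        refine hρ0 m' _ ?_
        change mcoeff m' (f - ∑ m'' ∈ A m', s m'') = 0
        rw [Finset.sum_eq_zero, sub_zero]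
        · by_contra h0
          have hne : m' ≠ m := fun h => o.irrefl m (h ▸ hgt)
          exact o.irrefl m (o.trans _ _ _ (hm.2 m' h0 hne) hgt)
        · intro m'' hm''
          have := (hA m' m'').1 hm''
          exact ih m'' this (o.trans _ _ _ this.2 hgt)
    have hcm : c m = mcoeff m f := by
      change mcoeff m (f - ∑ m'' ∈ A m, s m'') = _
      rw [Finset.sum_eq_zero, sub_zero]
      exact fun m' hm' => hs0 m' ((hA m m').1 hm').2
    rw [hr m (hd m hm.1), hs m, hcm, hρnL m _ hmL, mcoeff_zero, sub_zero]

/-! ### Leading terms and top forms by division -/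

theorem monomial_mem_leadingIdeal {S : Set (Mixed n R)} {f : Mixed n R} (hf : f ∈ S) {m : Mon n}
    (hm : IsLeadingMonomial o f m) :
    MvPolynomial.monomial m (mcoeff m f) ∈ leadingIdeal o S :=
  hm.leadingTerm_eq ▸ Ideal.subset_span ⟨f, hf, rfl⟩

theorem eq_zero_of_monomial_notMem (ho : o.IsTLocal) {r : Mixed n R} (hr : r ∈ I)
    (h : ∀ m ∈ msupport r,
      MvPolynomial.monomial m (mcoeff m r) ∉ leadingIdeal o (I : Set (Mixed n R))) : r = 0 := by
  by_contra h0
  obtain ⟨m, hm⟩ := exists_isLeadingMonomial ho h0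
  exact h m hm.1 (monomial_mem_leadingIdeal hr hm)

namespace IsAdaptedBasis

/-- Otherwise division would keep this term in the remainder, which is zero because its `o`-leading
term would lie in `lt(I)`. -/
theorem monomial_mem_of_weighted [IsNoetherianRing R] (hG : IsAdaptedBasis o v I G)
    (ho : o.IsTLocal) (hv : v 0 < 0) {d : ℕ} {f : Mixed n R} (hf : f ∈ I) (hd : IsXForm d f)
    {m : Mon n} (hm : IsLeadingMonomial (o.weighted v) f m) :
    MvPolynomial.monomial m (mcoeff m f) ∈ leadingIdeal o (I : Set (Mixed n R)) := by
  classical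
  by_contra hmL
  obtain ⟨r, hr, hrL, hrm⟩ := exists_remainder (o.hasFiniteUpperSets_weighted hv)
    (L := leadingIdeal o (I : Set (Mixed n R))) (fun m c hc => by
      obtain ⟨s, hs, hsd, hsc, hlt, -⟩ := hG.hasReducer ho hv hc m
      rw [MvPolynomial.coeff_monomial, if_pos rfl] at hsc
      exact ⟨s, hs, hsd, hsc, hlt⟩) hf hd
  have h0 := hrm m hm hmL
  rw [eq_zero_of_monomial_notMem ho hr hrL, mcoeff_zero] at h0
  exact hm.1 h0.symm

/-- Reducers cancel the weighted leading term until no term of weight `W` is left; each contributes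
an element of the span to the top form. -/
theorem exists_hasTopForm [IsNoetherianRing R] (hG : IsAdaptedBasis o v I G)
    (ho : o.IsTLocal) (hv : v 0 < 0) {d : ℕ} {W : ℝ} {f : Mixed n R} (hf : f ∈ I)
    (hd : IsXForm d f) (hW : ∀ m ∈ msupport f, wdeg v m ≤ W) :
    ∃ p ∈ Ideal.span (initialForm v '' G), HasTopForm v W f p := by
  classical
  have hfin := finite_xdeg_eq_le_wdeg hv d W
  have hstep : ∀ f ∈ I, IsXForm d f → (∀ m ∈ msupport f, wdeg v m ≤ W) →
      (∀ m ∈ msupport f, wdeg v m ≠ W) ∨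
      ∃ m ∈ msupport f, wdeg v m = W ∧ IsLeadingMonomial (o.weighted v) f m := by
    intro f hf hd hW
    by_cases hex : ∃ m ∈ msupport f, wdeg v m = W
    · right
      obtain ⟨m₀, hm₀, hW₀⟩ := hex
      obtain ⟨m, hm, hmax⟩ := (o.weighted v).exists_greatest
        (L := hfin.toFinset.filter fun m => m ∈ msupport f)
        ⟨m₀, by simp [hd m₀ hm₀, hW₀, hm₀]⟩
      simp only [Finset.mem_filter, Set.Finite.mem_toFinset, Set.mem_ofPred_eq] at hm hmax
      have hmW := le_antisymm (hW m hm.2) hm.1.2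
      refine ⟨m, hm.2, hmW, hm.2, fun m' hm' hne => ?_⟩
      rcases (hW m' hm').lt_or_eq with h | h
      · exact Or.inl (hmW ▸ h)
      · exact hmax m' ⟨⟨hd m' hm', h.ge⟩, hm'⟩ hne
    · left
      push Not at hex
      exact hex
  have hlow : ∀ f : Mixed n R, (∀ m ∈ msupport f, wdeg v m ≤ W) →
      (∀ m ∈ msupport f, wdeg v m ≠ W) → HasTopForm v W f 0 := fun f h1 h2 =>
    ⟨h1, fun m hm => by
      by_contra h0
      exact h2 m (fun h => h0 (by rw [h, MvPolynomial.coeff_zero])) hm, fun m _ => by simp⟩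
  -- The induction runs on the number of monomials of degree `d` and weight `W` that are `o`-smaller
  -- than the leading one.
  suffices hmain : ∀ (k : ℕ) (f : Mixed n R), f ∈ I → IsXForm d f →
      (∀ m ∈ msupport f, wdeg v m ≤ W) → ∀ m, wdeg v m = W →
      IsLeadingMonomial (o.weighted v) f m →
      (hfin.toFinset.filter fun m' => wdeg v m' = W ∧ o.gt m m').card = k →
      ∃ p ∈ Ideal.span (initialForm v '' G), HasTopForm v W f p by
    rcases hstep f hf hd hW with h | ⟨m, -, hmW, hlead⟩
    · exact ⟨0, Ideal.zero_mem _, hlow f hW h⟩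
    · exact hmain _ f hf hd hW m hmW hlead rfl
  intro k
  induction k using Nat.strong_induction_on with
  | _ k ih =>
    rintro f hf hd hW m rfl hlead rfl
    have hmL := hG.monomial_mem_of_weighted ho hv hf hd hlead
    obtain ⟨s, hs, hsd, hsc, hlt, p, hp, hsp⟩ := hG.hasReducer ho hv hmL m
    rw [MvPolynomial.coeff_monomial, if_pos rfl] at hsc
    rw [hd m hlead.1] at hsd
    have hfs : f - s ∈ I := I.sub_mem hf hs
    have hfsd := hd.sub hsd
    have hfsW : ∀ m' ∈ msupport (f - s), wdeg v m' ≤ wdeg v m := fun m' hm' =>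
      (mem_or_mem_of_mem_msupport_sub hm').elim (hW m') (hsp.1 m')
    have hfslt : ∀ m' ∈ msupport (f - s), (o.weighted v).gt m m' := by
      intro m' hm'
      have hne : m' ≠ m := by
        rintro rfl
        exact hm' (by rw [mcoeff_sub, hsc, sub_self])
      exact (mem_or_mem_of_mem_msupport_sub hm').elim (fun h => hlead.2 m' h hne)
        fun h => hlt m' h hne
    obtain ⟨q, hq, hfsq⟩ : ∃ q ∈ Ideal.span (initialForm v '' G),
        HasTopForm v (wdeg v m) (f - s) q := by
      rcases hstep (f - s) hfs hfsd hfsW with h | ⟨m', hm', hmW, hlead'⟩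
      · exact ⟨0, Ideal.zero_mem _, hlow _ hfsW h⟩
      · have hgt : o.gt m m' := ((hfslt m' hm').resolve_left (by linarith)).2
        refine ih _ (Finset.card_lt_card ?_) (f - s) hfs hfsd hfsW m' hmW hlead' rfl
        refine (Finset.ssubset_iff_of_subset fun a ha => ?_).2 ⟨m', ?_, ?_⟩
        · rw [Finset.mem_filter] at ha ⊢
          exact ⟨ha.1, ha.2.1, o.trans _ _ _ hgt ha.2.2⟩
        · simp [hmW, hgt, hfsd m' hm']
        · simp [o.irrefl]
    refine ⟨q + p, Ideal.add_mem _ hq hp, ?_⟩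
    simpa using hfsq.add hsp

end IsAdaptedBasis

/-! ### Elements of initial ideals -/

/-- An element of the initial ideal can mix weights and degrees, but each component of fixed weight
and degree lifts to `I`. Fixing both makes the claim additive and stable under monomial multiples.
-/
theorem exists_mem_of_mem_initialIdeal (hI : IsXHomogeneous I) (hv : v 0 < 0) {h : Poly n R}
    (hh : h ∈ initialIdeal v I) (W : ℝ) (d : ℕ) :
    ∃ f ∈ I, IsXForm d f ∧ (∀ m ∈ msupport f, wdeg v m ≤ W) ∧
      ∀ m, xdeg m = d → wdeg v m = W → mcoeff m f = h.coeff m := by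
  classical
  have hzero : ∀ W d, ∃ f ∈ I, IsXForm d f ∧ (∀ m ∈ msupport f, wdeg v m ≤ W) ∧
      ∀ m, xdeg m = d → wdeg v m = W → mcoeff m f = (0 : Poly n R).coeff m := fun W d =>
    ⟨0, I.zero_mem, isXForm_zero d, fun m hm => absurd (mcoeff_zero m) hm, fun m _ _ => by simp⟩
  induction hh using Submodule.span_induction generalizing W d with
  | mem h hh =>
    obtain ⟨f, hf, rfl⟩ := hh
    by_cases hf0 : f = 0
    · have : initialForm v (0 : Mixed n R) = 0 := by
        ext m
        rw [coeff_initialForm hv]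
        simp
      rw [hf0, this]
      exact hzero W d
    obtain ⟨l, hl⟩ := exists_mem_initialSupport hv hf0
    have htop := hasTopForm_initialForm hv hl
    by_cases hlW : wdeg v l = W
    · subst hlW
      refine ⟨_, hI.homogeneousComponent_mem hf d, isXForm_homogeneousComponent d f,
        fun m hm => ?_, fun m hmd hm => ?_⟩
      · refine htop.1 m fun h0 => hm ?_
        rw [mcoeff_homogeneousComponent, h0, ite_self]
      · rw [mcoeff_homogeneousComponent, if_pos hmd, htop.2.1 m hm]
    · obtain ⟨f', hf', hd', hW', h'⟩ := hzero W d
      refine ⟨f', hf', hd', hW', fun m hmd hm => ?_⟩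
      rw [h' m hmd hm, htop.2.2 m fun h => hlW (h ▸ hm), MvPolynomial.coeff_zero]
  | zero => exact hzero W d
  | add p q _ _ hp hq =>
    obtain ⟨f, hf, hfd, hfW, hfp⟩ := hp W d
    obtain ⟨g, hg, hgd, hgW, hgq⟩ := hq W d
    refine ⟨f + g, I.add_mem hf hg, hfd.add hgd,
      fun m hm => (mem_or_mem_of_mem_msupport_add hm).elim (hfW m) (hgW m), fun m hmd hm => ?_⟩
    rw [mcoeff_add, hfp m hmd hm, hgq m hmd hm, MvPolynomial.coeff_add]
  | smul a p _ hp =>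
    rw [smul_eq_mul]
    induction a using MvPolynomial.induction_on' generalizing W d with
    | monomial u a =>
      by_cases hud : xdeg u ≤ d
      · obtain ⟨e, rfl⟩ := exists_add_of_le hud
        obtain ⟨f, hf, hfd, hfW, hfp⟩ := hp (W - wdeg v u) e
        refine ⟨_, I.mul_mem_left _ hf, hfd.monomial_mul u a, fun m hm => ?_, fun m hmd hm => ?_⟩
        · obtain ⟨m', hm', rfl⟩ := exists_of_mem_msupport_monomial_mul hm
          rw [wdeg_add]
          linarith [hfW m' hm']
        · by_cases hu : u ≤ m
          · obtain ⟨m', rfl⟩ := exists_add_of_le hu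
            rw [xdeg_add] at hmd
            rw [wdeg_add] at hm
            rw [mcoeff_monomial_mul, MvPolynomial.coeff_monomial_mul,
              hfp m' (by omega) (by linarith)]
          · rw [mcoeff_monomial_mul_of_not_le hu, MvPolynomial.coeff_monomial_mul', if_neg hu]
      · obtain ⟨f', hf', hd', hW', h'⟩ := hzero W d
        refine ⟨f', hf', hd', hW', fun m hmd hm => ?_⟩
        rw [h' m hmd hm, MvPolynomial.coeff_monomial_mul', if_neg, MvPolynomial.coeff_zero]
        intro hu
        obtain ⟨m', rfl⟩ := exists_add_of_le hu
        rw [xdeg_add] at hmd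
        omega
    | add a b ha hb =>
      obtain ⟨f, hf, hfd, hfW, hfp⟩ := ha W d
      obtain ⟨g, hg, hgd, hgW, hgq⟩ := hb W d
      refine ⟨f + g, I.add_mem hf hg, hfd.add hgd,
        fun m hm => (mem_or_mem_of_mem_msupport_add hm).elim (hfW m) (hgW m), fun m hmd hm => ?_⟩
      rw [mcoeff_add, hfp m hmd hm, hgq m hmd hm, add_mul, MvPolynomial.coeff_add]

namespace IsAdaptedBasis

/-- The component of `h` in the weight and degree of `m` lifts to some `f ∈ I` whose other terms
have smaller weight, so `m` leads `f` for the weighted ordering. -/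
theorem monomial_mem_of_mem_initialIdeal [IsNoetherianRing R] (hG : IsAdaptedBasis o v I G)
    (hI : IsXHomogeneous I) (ho : o.IsTLocal) (hv : v 0 < 0) {h : Poly n R}
    (hh : h ∈ initialIdeal v I) {m : Mon n} (hm : IsLeadingMonomial o (toMixed h) m) :
    MvPolynomial.monomial m (h.coeff m) ∈ leadingIdeal o (I : Set (Mixed n R)) := by
  obtain ⟨f, hf, hd, hW, hfh⟩ := exists_mem_of_mem_initialIdeal hI hv hh (wdeg v m) (xdeg m)
  rw [← hfh m rfl rfl]
  refine hG.monomial_mem_of_weighted ho hv hf hd ⟨?_, fun m' hm' hne => ?_⟩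
  · rw [mem_msupport, hfh m rfl rfl, ← mcoeff_toMixed]
    exact hm.1
  · rcases (hW m' hm').lt_or_eq with h1 | h1
    · exact Or.inl h1
    · refine Or.inr ⟨h1.symm, hm.2 m' ?_ hne⟩
      rw [mem_msupport, mcoeff_toMixed, ← hfh m' (hd m' hm') h1]
      exact hm'

/-- The homogeneous components of `f` lie in `I`, and their top forms, all taken at the maximal
weight of `f`, add up to the initial form. -/
theorem initialIdeal_eq_span [IsNoetherianRing R] (hG : IsAdaptedBasis o v I G)
    (hI : IsXHomogeneous I) (ho : o.IsTLocal) (hv : v 0 < 0) :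
    initialIdeal v I = Ideal.span (initialForm v '' G) := by
  classical
  refine le_antisymm (Ideal.span_le.2 ?_) (Ideal.span_mono (Set.image_mono hG.subset))
  rintro _ ⟨f, hf, rfl⟩
  by_cases hf0 : initialForm v f = 0
  · rw [hf0]
    exact Ideal.zero_mem _
  obtain ⟨m, hm⟩ := MvPolynomial.ne_zero_iff.1 hf0
  rw [coeff_initialForm hv] at hm
  have hmem : m ∈ initialSupport v f := by
    by_contra h
    exact hm (if_neg h)
  have key : ∀ d, ∃ p ∈ Ideal.span (initialForm v '' G),
      HasTopForm v (wdeg v m) (MvPolynomial.homogeneousComponent d f) p := by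
    intro d
    refine hG.exists_hasTopForm ho hv (hI.homogeneousComponent_mem hf d)
      (isXForm_homogeneousComponent d f) fun m' hm' => hmem.2 m' fun h0 => hm' ?_
    rw [mcoeff_homogeneousComponent, h0, ite_self]
  choose p hp hfp using key
  have hsum : ∀ N : ℕ, HasTopForm v (wdeg v m)
      (∑ d ∈ Finset.range N, MvPolynomial.homogeneousComponent d f)
      (∑ d ∈ Finset.range N, p d) := by
    intro N
    induction N with
    | zero => simpa using hasTopForm_zero (wdeg v m)
    | succ N ih =>
      rw [Finset.sum_range_succ, Finset.sum_range_succ]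
      exact ih.add (hfp N)
  have htop := hsum (f.totalDegree + 1)
  rw [MvPolynomial.sum_homogeneousComponent] at htop
  have hinit := hasTopForm_initialForm hv hmem
  have : initialForm v f = ∑ d ∈ Finset.range (f.totalDegree + 1), p d := by
    ext m'
    by_cases hm' : wdeg v m' = wdeg v m
    · rw [hinit.2.1 m' hm', htop.2.1 m' hm']
    · rw [hinit.2.2 m' hm', htop.2.2 m' hm']
  rw [this]
  exact Ideal.sum_mem _ fun d _ => hp d

end IsAdaptedBasis

end AdaptedBasis


/-! ### Lowest terms -/

/-- `m` has the least exponent of `t` among the monomials of `g` with the same `x ^ α`. -/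
def IsLowest (g : Mixed n R) (m : Mon n) : Prop :=
  m ∈ msupport g ∧ m 0 = (g.coeff m.tail).order.toNat

theorem isLowest_of_forall {g : Mixed n R} {m : Mon n} (hm : m ∈ msupport g)
    (h : ∀ m' ∈ msupport g, ∀ k : ℕ, k ≠ 0 → m ≠ m' + Finsupp.single 0 k) : IsLowest g m := by
  refine ⟨hm, ?_⟩
  have hne : g.coeff m.tail ≠ 0 := fun h0 => hm (by simp [mcoeff, h0])
  have hle : (g.coeff m.tail).order.toNat ≤ m 0 :=
    ENat.toNat_le_of_le_natCast (PowerSeries.order_le _ hm)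
  by_contra hlt
  refine h (Finsupp.cons (g.coeff m.tail).order.toNat m.tail) ?_
    (m 0 - (g.coeff m.tail).order.toNat) (by omega) ?_
  · simpa [mem_msupport, mcoeff] using PowerSeries.coeff_order hne
  · ext i
    refine Fin.cases ?_ (fun j => ?_) i
    · simp only [Finsupp.add_apply, Finsupp.cons_zero, Finsupp.single_eq_same]
      omega
    · simp [Finsupp.tail_apply]

theorem IsLeadingMonomial.isLowest (ho : o.IsTLocal) {g : Mixed n R} {m : Mon n}
    (hm : IsLeadingMonomial o g m) : IsLowest g m := by
  refine isLowest_of_forall hm.1 fun m' hm' k hk h => ?_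
  have hgt := ho.gt_add m' k hk
  rw [← h] at hgt
  have hne : m' ≠ m := fun h' => o.irrefl m (h' ▸ hgt)
  exact o.irrefl m (o.trans _ _ _ (hm.2 m' hm' hne) hgt)

/-- Lowering the power of `t` raises the weight. -/
theorem isLowest_of_mem_initialSupport (hv : v 0 < 0) {g : Mixed n R} {m : Mon n}
    (hm : m ∈ initialSupport v g) : IsLowest g m := by
  refine isLowest_of_forall hm.1 fun m' hm' k hk h => ?_
  have hle := hm.2 m' hm'
  rw [h, wdeg_add_single] at hle
  have hk' : (0 : ℝ) < k := by exact_mod_cast Nat.pos_of_ne_zero hk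
  nlinarith

theorem mcoeff_C (m : Mon n) (φ : PowerSeries R) :
    mcoeff m (MvPolynomial.C φ : Mixed n R) =
      if m.tail = 0 then PowerSeries.coeff (m 0) φ else 0 := by
  classical
  rw [mcoeff, MvPolynomial.coeff_C]
  by_cases h : m.tail = 0
  · rw [if_pos h.symm, if_pos h]
  · rw [if_neg fun h' => h h'.symm, if_neg h, map_zero]

theorem eq_single_zero_of_tail_eq_zero {m : Mon n} (h : m.tail = 0) :
    m = Finsupp.single 0 (m 0) := by
  rw [← Finsupp.cons_zero_eq_single_zero, ← h, Finsupp.cons_tail]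

theorem isLeadingMonomial_C (ho : o.IsTLocal) {φ : PowerSeries R} (hφ : φ ≠ 0) :
    IsLeadingMonomial o (MvPolynomial.C φ : Mixed n R) (Finsupp.single 0 φ.order.toNat) := by
  obtain ⟨m, hm⟩ := exists_isLeadingMonomial (n := n) ho
    ((map_ne_zero_iff _ (MvPolynomial.C_injective _ _)).2 hφ)
  have hlow := (hm.isLowest ho).2
  have htail : m.tail = 0 := by
    by_contra h
    exact hm.1 ((mcoeff_C m φ).trans (if_neg h))
  rw [htail, MvPolynomial.coeff_zero_C] at hlow
  rw [← hlow, ← eq_single_zero_of_tail_eq_zero htail]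
  exact hm

theorem initialPart_eq (ho : o.IsTLocal) (g : Mixed n R) :
    initialPart o g = ∑ α ∈ g.support, MvPolynomial.monomial α
      (PowerSeries.monomial (g.coeff α).order.toNat
        (PowerSeries.coeff (g.coeff α).order.toNat (g.coeff α))) := by
  refine Finset.sum_congr rfl fun α hα => ?_
  have htail : ∀ k, (Finsupp.single 0 k : Mon n).tail = 0 := by
    intro k; ext i; simp [Finsupp.tail_apply]
  rw [(isLeadingMonomial_C ho (MvPolynomial.mem_support_iff.1 hα)).leadingTerm_eq, mcoeff_C,
    if_pos (htail _), toMixed_monomial, htail, MvPolynomial.monomial_mul, zero_add, mul_one,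
    Finsupp.single_eq_same]

theorem mcoeff_initialPart (ho : o.IsTLocal) (g : Mixed n R) (m : Mon n) :
    mcoeff m (initialPart o g) =
      if m 0 = (g.coeff m.tail).order.toNat then mcoeff m g else 0 := by
  classical
  rw [initialPart_eq ho, mcoeff, MvPolynomial.coeff_sum]
  simp only [MvPolynomial.coeff_monomial, Finset.sum_ite_eq', MvPolynomial.mem_support_iff]
  by_cases h : g.coeff m.tail = 0
  · simp [h, mcoeff]
  · rw [if_pos h, PowerSeries.coeff_monomial]
    split_ifs with h1
    · rw [mcoeff, h1]
    · rfl

theorem mem_msupport_initialPart (ho : o.IsTLocal) {g : Mixed n R} {m : Mon n} :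
    m ∈ msupport (initialPart o g) ↔ IsLowest g m := by
  rw [mem_msupport, mcoeff_initialPart ho, IsLowest, mem_msupport]
  split_ifs with h <;> simp [h]

theorem IsLeadingMonomial.initialPart (ho : o.IsTLocal) {g : Mixed n R} {m : Mon n}
    (hm : IsLeadingMonomial o g m) : IsLeadingMonomial o (initialPart o g) m :=
  ⟨(mem_msupport_initialPart ho).2 (hm.isLowest ho),
    fun m' hm' => hm.2 m' ((mem_msupport_initialPart ho).1 hm').1⟩

theorem mcoeff_tail_of_ne {f : Mixed n R} {l m : Mon n} (hl : IsLeadingMonomial o f l)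
    (hne : m ≠ l) : mcoeff m (tail o f) = mcoeff m f := by
  classical
  rw [tail, mcoeff_sub, mcoeff_toMixed, hl.leadingTerm_eq, MvPolynomial.coeff_monomial,
    if_neg hne.symm, sub_zero]

/-- An ideal generated by terms contains every term of its elements. -/
theorem monomial_coeff_mem_leadingIdeal {S : Set (Mixed n R)} {h : Poly n R}
    (hh : h ∈ leadingIdeal o S) (m : Mon n) :
    MvPolynomial.monomial m (h.coeff m) ∈ leadingIdeal o S := by
  classical
  induction hh using Submodule.span_induction generalizing m with
  | mem h hh =>
    obtain ⟨g, hg, rfl⟩ := hh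
    by_cases hex : ∃ l, IsLeadingMonomial o g l
    · obtain ⟨l, hl⟩ := hex
      rw [hl.leadingTerm_eq, MvPolynomial.coeff_monomial]
      split_ifs with hlm
      · exact hlm ▸ monomial_mem_leadingIdeal hg hl
      · simp
    · rw [leadingTerm, dif_neg hex]
      simp
  | zero => simp
  | add p q _ _ hp hq =>
    rw [MvPolynomial.coeff_add, map_add]
    exact Ideal.add_mem _ (hp m) (hq m)
  | smul a p _ hp =>
    rw [smul_eq_mul]
    induction a using MvPolynomial.induction_on' with
    | monomial u a =>
      by_cases hu : u ≤ m
      · obtain ⟨m', rfl⟩ := exists_add_of_le hu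
        rw [MvPolynomial.coeff_monomial_mul, ← MvPolynomial.monomial_mul]
        exact Ideal.mul_mem_left _ _ (hp m')
      · rw [MvPolynomial.coeff_monomial_mul', if_neg hu]
        simp
    | add a b ha hb =>
      rw [add_mul, MvPolynomial.coeff_add, map_add]
      exact Ideal.add_mem _ ha hb

/-! ### Initially reduced standard bases -/

theorem exists_isLeadingMonomial_toMixed (ho : o.IsTLocal) {h : Poly n R} (hh : h ≠ 0) :
    ∃ m, IsLeadingMonomial o (toMixed h) m := by
  refine exists_isLeadingMonomial ho fun h0 => hh ?_
  ext m
  rw [← mcoeff_toMixed, h0, mcoeff_zero, MvPolynomial.coeff_zero]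

namespace IsInitiallyReducedStandardBasis

variable {G : Finset (Mixed n R)}

/-- The lowest terms of `g` are the terms of `g'`, and reducedness excludes those in its tail from
`lt(I)`. -/
theorem eq_of_monomial_mem (hG : IsInitiallyReducedStandardBasis o I G) (ho : o.IsTLocal)
    {g : Mixed n R} (hg : g ∈ G) {l m : Mon n} (hl : IsLeadingMonomial o g l) (hm : IsLowest g m)
    (hmem : MvPolynomial.monomial m (mcoeff m g) ∈ leadingIdeal o (I : Set (Mixed n R))) :
    m = l := by
  by_contra hne
  have hc : mcoeff m (tail o (initialPart o g)) = mcoeff m g := by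
    rw [mcoeff_tail_of_ne (hl.initialPart ho) hne, mcoeff_initialPart ho, if_pos hm.2]
  have := hG.2.2 _ ⟨g, hg, rfl⟩ m (by rw [mem_msupport, hc]; exact hm.1)
  rw [hc, hG.1.2] at this
  exact this hmem

/-- The leading term of each nonzero homogeneous component of `g` is a lowest term of `g` in
`lt(I)`, hence `lt(g)`; so there is only one such component. -/
theorem exists_isXForm (hG : IsInitiallyReducedStandardBasis o I G) (ho : o.IsTLocal)
    (hI : IsXHomogeneous I) {g : Mixed n R} (hg : g ∈ G) : ∃ d, IsXForm d g := by
  by_cases hg0 : g = 0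
  · exact ⟨0, hg0 ▸ isXForm_zero 0⟩
  obtain ⟨l, hl⟩ := exists_isLeadingMonomial ho hg0
  refine ⟨xdeg l, fun m hm => ?_⟩
  have hne : MvPolynomial.homogeneousComponent (xdeg m) g ≠ 0 := by
    intro h0
    apply hm
    have := mcoeff_homogeneousComponent (xdeg m) g m
    rw [h0, if_pos rfl, mcoeff_zero] at this
    exact this.symm
  obtain ⟨l', hl'⟩ := exists_isLeadingMonomial ho hne
  have hdeg : xdeg l' = xdeg m := isXForm_homogeneousComponent _ _ l' hl'.1
  have hc : mcoeff l' (MvPolynomial.homogeneousComponent (xdeg m) g) = mcoeff l' g := by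
    rw [mcoeff_homogeneousComponent, if_pos hdeg]
  have hlow : IsLowest g l' := by
    refine ⟨?_, ?_⟩
    · rw [mem_msupport, ← hc]
      exact hl'.1
    · rw [(hl'.isLowest ho).2, MvPolynomial.coeff_homogeneousComponent]
      exact congrArg _ (congrArg _ (if_pos hdeg))
  have hmem := monomial_mem_leadingIdeal (hI.homogeneousComponent_mem (hG.1.1 hg) (xdeg m)) hl'
  rw [hc] at hmem
  rw [← hdeg, hG.eq_of_monomial_mem ho hg hl hlow hmem]

theorem selectsLeading_of_initialIdeal_eq (hG : IsInitiallyReducedStandardBasis o I G)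
    (ho : o.IsTLocal) (hv : v 0 < 0)
    (h : initialIdeal v I = leadingIdeal o (I : Set (Mixed n R))) {g : Mixed n R} (hg : g ∈ G) :
    SelectsLeading o v g := by
  classical
  intro l hl
  obtain ⟨m, hm⟩ := exists_mem_initialSupport hv (f := g) fun h0 =>
    hl.1 (by rw [h0, mcoeff_zero])
  have hmem : initialForm v g ∈ initialIdeal v I := Ideal.subset_span ⟨g, hG.1.1 hg, rfl⟩
  rw [h] at hmem
  have := monomial_coeff_mem_leadingIdeal hmem m
  rw [coeff_initialForm hv, if_pos hm] at this
  exact hG.eq_of_monomial_mem ho hg hl (isLowest_of_mem_initialSupport hv hm) this ▸ hm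

/-- Each inequality `wdeg u m ≤ wdeg u l` is closed in `u`, so it passes to the closure. -/
theorem selectsLeading_of_mem_leadingCone (hG : IsInitiallyReducedStandardBasis o I G)
    (ho : o.IsTLocal) {w : Fin (n + 1) → ℝ} (hw : w ∈ leadingCone o I) {g : Mixed n R}
    (hg : g ∈ G) : SelectsLeading o w g := by
  intro l hl
  refine ⟨hl.1, fun m hm => ?_⟩
  have hcont : ∀ a : Mon n, Continuous fun u : Fin (n + 1) → ℝ => wdeg u a := fun a => by
    unfold wdeg
    fun_prop
  exact closure_minimal (t := {u | wdeg u m ≤ wdeg u l})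
    (fun u hu => (hG.selectsLeading_of_initialIdeal_eq ho hu.1 hu.2 hg l hl).2 m hm)
    (isClosed_le (hcont m) (hcont l)) hw

theorem isAdaptedBasis (hG : IsInitiallyReducedStandardBasis o I G) (ho : o.IsTLocal)
    (hI : IsXHomogeneous I) (hv : ∀ g ∈ G, SelectsLeading o v g) :
    IsAdaptedBasis o v I (G : Set (Mixed n R)) :=
  ⟨hG.1.1, hG.1.2, fun _ hg => hG.exists_isXForm ho hI hg, hv⟩

end IsInitiallyReducedStandardBasis

/-! ### Comparing initial forms and initial ideals -/

theorem mem_initialSupport_of_coeff_ne_zero (hv : v 0 < 0) {f : Mixed n R} {m : Mon n}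
    (h : (initialForm v f).coeff m ≠ 0) :
    m ∈ initialSupport v f ∧ (initialForm v f).coeff m = mcoeff m f := by
  classical
  rw [coeff_initialForm hv] at h ⊢
  split_ifs at h ⊢ with hm
  · exact ⟨hm, rfl⟩
  · exact absurd rfl h

theorem coeff_initialForm_of_mem (hv : v 0 < 0) {f : Mixed n R} {m : Mon n}
    (h : m ∈ initialSupport v f) : (initialForm v f).coeff m = mcoeff m f := by
  classical
  rw [coeff_initialForm hv, if_pos h]

theorem initialForm_zero (hv : v 0 < 0) : initialForm v (0 : Mixed n R) = 0 := by
  by_contra h0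
  obtain ⟨m, hm⟩ := MvPolynomial.ne_zero_iff.1 h0
  exact (mem_initialSupport_of_coeff_ne_zero hv hm).1.1 (mcoeff_zero m)

/-- For weights selecting the leading terms of an initially reduced standard basis, equality of
initial ideals is equality of the initial forms of the basis. -/
theorem IsInitiallyReducedStandardBasis.initialIdeal_eq_iff [IsNoetherianRing R]
    {G : Finset (Mixed n R)} (hG : IsInitiallyReducedStandardBasis o I G) (ho : o.IsTLocal)
    (hI : IsXHomogeneous I) {w : Fin (n + 1) → ℝ} (hw0 : w 0 < 0)
    (hsel : ∀ g ∈ G, SelectsLeading o w g) (hv : v 0 < 0) :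
    initialIdeal v I = initialIdeal w I ↔ ∀ g ∈ G, initialForm v g = initialForm w g := by
  have hGw := hG.isAdaptedBasis ho hI hsel
  constructor
  · intro heq g hg
    by_cases hg0 : g = 0
    · rw [hg0, initialForm_zero hv, initialForm_zero hw0]
    obtain ⟨l, hl⟩ := exists_isLeadingMonomial ho hg0
    have hvmem : initialForm v g ∈ initialIdeal w I :=
      heq ▸ Ideal.subset_span ⟨g, hG.1.1 hg, rfl⟩
    have hwmem : initialForm w g ∈ initialIdeal w I := Ideal.subset_span ⟨g, hG.1.1 hg, rfl⟩
    -- The `o`-leading term of `in_v(g)`, an element of `in_w(I)`, lies in `lt(I)` and is lowest in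
    -- `g`.
    have hlv : l ∈ initialSupport v g := by
      have hne : initialForm v g ≠ 0 := by
        obtain ⟨m, hm⟩ := exists_mem_initialSupport hv hg0
        intro h0
        refine hm.1 ?_
        rw [← coeff_initialForm_of_mem hv hm, h0, MvPolynomial.coeff_zero]
      obtain ⟨m, hm⟩ := exists_isLeadingMonomial_toMixed ho hne
      have hmL := hGw.monomial_mem_of_mem_initialIdeal hI ho hw0 hvmem hm
      have hm1 := hm.1
      rw [mem_msupport, mcoeff_toMixed] at hm1
      obtain ⟨hmv, hc⟩ := mem_initialSupport_of_coeff_ne_zero hv hm1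
      rw [hc] at hmL
      exact hG.eq_of_monomial_mem ho hg hl (isLowest_of_mem_initialSupport hv hmv) hmL ▸ hmv
    have hlw := hsel g hg l hl
    by_contra hne
    obtain ⟨m, hm⟩ := exists_isLeadingMonomial_toMixed ho (sub_ne_zero.2 hne)
    have hmL := hGw.monomial_mem_of_mem_initialIdeal hI ho hw0 (Ideal.sub_mem _ hvmem hwmem) hm
    have hm1 := hm.1
    rw [mem_msupport, mcoeff_toMixed] at hm1
    rw [MvPolynomial.coeff_sub] at hm1 hmL
    -- Both forms take their coefficients from `g`, so a monomial of the difference occurs in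
    -- exactly one of them, and its term is up to sign a lowest term of `g`.
    have key : m = l := by
      by_cases hmv : (initialForm v g).coeff m = 0
      · rw [hmv, zero_sub] at hm1 hmL
        obtain ⟨hmw, hc⟩ := mem_initialSupport_of_coeff_ne_zero hw0 (neg_ne_zero.1 hm1)
        rw [hc, map_neg, neg_mem_iff] at hmL
        exact hG.eq_of_monomial_mem ho hg hl (isLowest_of_mem_initialSupport hw0 hmw) hmL
      · obtain ⟨hmv', hc⟩ := mem_initialSupport_of_coeff_ne_zero hv hmv
        by_cases hmw : (initialForm w g).coeff m = 0
        · rw [hmw, sub_zero, hc] at hmL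
          exact hG.eq_of_monomial_mem ho hg hl (isLowest_of_mem_initialSupport hv hmv') hmL
        · rw [hc, (mem_initialSupport_of_coeff_ne_zero hw0 hmw).2, sub_self] at hm1
          exact absurd rfl hm1
    apply hm1
    rw [key, coeff_initialForm_of_mem hv hlv, coeff_initialForm_of_mem hw0 hlw, sub_self]
  · intro heq
    -- `lt(g)` occurs in `in_w(g) = in_v(g)`, so `v` selects it as well.
    have hGv := hG.isAdaptedBasis (v := v) ho hI fun g hg l hl => by
      refine (mem_initialSupport_of_coeff_ne_zero hv ?_).1
      rw [heq g hg, coeff_initialForm_of_mem hw0 (hsel g hg l hl)]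
      exact hl.1
    rw [hGv.initialIdeal_eq_span hI ho hv, hGw.initialIdeal_eq_span hI ho hw0,
      Set.image_congr heq]

end

end GroebnerFan

theorem proposition3p12 {R : Type*} [CommRing R] [IsNoetherianRing R] {n : ℕ}
    (o : GroebnerFan.MonomialOrdering n) (ho : o.IsTLocal)
    (I : Ideal (GroebnerFan.Mixed n R)) (hI : GroebnerFan.IsXHomogeneous I)
    (G : Finset (GroebnerFan.Mixed n R))
    (hG : GroebnerFan.IsInitiallyReducedStandardBasis o I G)
    (w : Fin (n + 1) → ℝ) (hw : w ∈ GroebnerFan.leadingCone o I) (hw0 : w 0 < 0) :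
    ∀ v : Fin (n + 1) → ℝ, v 0 < 0 →
      (GroebnerFan.initialIdeal v I = GroebnerFan.initialIdeal w I ↔
        ∀ g ∈ G, GroebnerFan.initialForm v g = GroebnerFan.initialForm w g) := by
  intro v hv
  exact hG.initialIdeal_eq_iff ho hI hw0
    (fun g hg => hG.selectsLeading_of_mem_leadingCone ho hw hg) hv
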